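/- Let $1\le\chi\le 2$, $p\ge\chi$ and $\zeta,\eta\ge 0$ be real numbers, let $\varrho^{(\zeta,\eta)}(u)=(1-u)^\zeta(1+u)^\eta$ and $d\mu_{\zeta,\eta}(u)=\varrho^{(\zeta,\eta)}(u)\,du$, and let $[a,b]\subseteq[-1,1]$ be a segment on which $\varrho^{(\zeta,\eta)}\le 1$. Let $\mathfrak X(v,\varpi)$, $v\in\mathbb R$, be a symmetric stable process of index $\chi$ on a probability space, that is, a real process with independent increments for which there is a constant $C>0$ such that, for all $s\le t$, the increment $\mathfrak X(t)-\mathfrak X(s)$ has the characteristic function $x\mapsto\exp\{-C(t-s)|x|^\chi\}$. For a continuous function $f$, the integral of $f$ with respect to a process means the limit in probability, when it exists, of the Riemann--Stieltjes sums $\sum_i f(\xi_i)\,[\mathfrak X(t_{i+1})-\mathfrak X(t_i)]$ (with arbitrary tags $\xi_i\in[t_i,t_{i+1}]$) as the mesh of the partition $(t_i)$ tends to zero. Then the process $$Y_{\zeta,\eta}(v,\varpi)=\int_a^v\varrho^{(\zeta,\eta)}(s)\,d\mathfrak X(s,\varpi),\qquad v\in[a,b],$$ exists, and for every $\mathfrak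 g\in \mathrm L^p_{[a,b]}(d\mu_{\zeta,\eta})$ the integral $\int_a^b\mathfrak g(v)\,dY_{\zeta,\eta}(v,\varpi)$ can be defined in probability, in the following sense. The integral $\int_a^b f(v)\,dY_{\zeta,\eta}(v,\varpi)$ exists for every continuous $f$ on $[a,b]$; there are sequences $(\mathfrak g_m)$ of continuous functions on $[a,b]$ with $\int_a^b|\mathfrak g_m-\mathfrak g|^p\,d\mu_{\zeta,\eta}\to 0$; and there is a random variable $\int_a^b\mathfrak g\,dY_{\zeta,\eta}$, unique up to almost sure equality, such that for every such sequence $(\mathfrak g_m)$ the integrals $\int_a^b\mathfrak g_m\,dY_{\zeta,\eta}$ converge to it in probability as $m\to\infty$. In particular the limit does not depend on the choice of the sequence. -/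

import Mathlib

open MeasureTheory ProbabilityTheory Filter Set
open scoped Topology ENNReal

noncomputable section

/-- The Jacobi weight `(1 - u) ^ ζ * (1 + u) ^ η`. -/
def jacobiWeight (ζ η u : ℝ) : ℝ := (1 - u) ^ ζ * (1 + u) ^ η

/-- The measure `(1 - u) ^ ζ * (1 + u) ^ η du` on the segment `[-1, 1]`. -/
def jacobiMeasure (ζ η : ℝ) : Measure ℝ :=
  (volume.restrict (Icc (-1) 1)).withDensity fun u => ENNReal.ofReal (jacobiWeight ζ η u)

/-- A symmetric stable process of index `χ`: a real-valued process on the line with independent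
increments such that, for one constant `C > 0`, the increment over `[s, t]` has the characteristic
function `x ↦ exp (-(t - s) * C * |x| ^ χ)`. -/
structure IsSymmetricStableProcess {Ω : Type*} [MeasurableSpace Ω] (P : Measure Ω) (χ : ℝ)
    (X : ℝ → Ω → ℝ) : Prop where
  measurable : ∀ t, Measurable (X t)
  indep : HasIndepIncrements X P
  charFun_eq : ∃ C : ℝ, 0 < C ∧ ∀ s t : ℝ, s ≤ t → ∀ x : ℝ,
    charFun (P.map fun ω => X t ω - X s ω) x = (Real.exp ((t - s) * (-C * |x| ^ χ)) : ℂ)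

/-- A tagged partition `a = point 0 ≤ point 1 ≤ ... ≤ point size = b` of `[a, b]`, with a tag in each
of its `size` intervals. (The values of `point` after `size` and of `tag` from `size` on play no
role.) -/
structure TaggedPartition (a b : ℝ) where
  size : ℕ
  point : ℕ → ℝ
  tag : ℕ → ℝ
  point_mono : Monotone point
  point_zero : point 0 = a
  point_size : point size = b
  tag_mem : ∀ i < size, tag i ∈ Icc (point i) (point (i + 1))

namespace TaggedPartition

/-- The length of the longest interval of the partition. -/
def mesh {a b : ℝ} (π : TaggedPartition a b) : ℝ :=
  ⨆ i : Fin π.size, (π.point (i + 1) - π.point i)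

/-- The filter on tagged partitions for limits "as the mesh tends to zero". -/
def meshToZero (a b : ℝ) : Filter (TaggedPartition a b) := comap mesh (𝓝 0)

/-- The Riemann-Stieltjes sum of `f` against the process `X`, a random variable. -/
def sum {Ω : Type*} {a b : ℝ} (π : TaggedPartition a b) (f : ℝ → ℝ) (X : ℝ → Ω → ℝ) (ω : Ω) : ℝ :=
  ∑ i ∈ Finset.range π.size, f (π.tag i) * (X (π.point (i + 1)) ω - X (π.point i) ω)

end TaggedPartition

/-- The random variable `I` is the stochastic integral `∫_a^b f dX`: the limit in probability of the
Riemann-Stieltjes sums as the mesh of the tagged partition of `[a, b]` tends to zero. -/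
def IsStieltjesIntegral {Ω : Type*} [MeasurableSpace Ω] (P : Measure Ω) (a b : ℝ) (f : ℝ → ℝ)
    (X : ℝ → Ω → ℝ) (I : Ω → ℝ) : Prop :=
  AEMeasurable I P ∧
    TendstoInMeasure P (fun (π : TaggedPartition a b) ω => π.sum f X ω)
      (TaggedPartition.meshToZero a b) I

/-- `Y v = ∫_a^v (1 - s) ^ ζ * (1 + s) ^ η dX(s)` for every `v` in `[a, b]`. -/
def IsJacobiProcess {Ω : Type*} [MeasurableSpace Ω] (P : Measure Ω) (ζ η a b : ℝ)
    (X Y : ℝ → Ω → ℝ) : Prop :=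
  ∀ v ∈ Icc a b, IsStieltjesIntegral P a v (jacobiWeight ζ η) X (Y v)

/-- `gm` is a sequence of continuous functions on `[a, b]` that converges to `g` in
`L^p([a, b], (1 - u) ^ ζ * (1 + u) ^ η du)`. -/
def IsContinuousApprox (ζ η p a b : ℝ) (g : ℝ → ℝ) (gm : ℕ → ℝ → ℝ) : Prop :=
  (∀ m, ContinuousOn (gm m) (Icc a b)) ∧
    Tendsto (fun m => eLpNorm (fun v => gm m v - g v) (ENNReal.ofReal p)
      ((jacobiMeasure ζ η).restrict (Icc a b))) atTop (𝓝 0)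

/-- `Z` is the limit in probability of `∫_a^b gm m dY` for every sequence `gm` of continuous
functions that converges to `g` in `L^p`. -/
def IsLimitIntegral {Ω : Type*} [MeasurableSpace Ω] (P : Measure Ω) (ζ η p a b : ℝ) (g : ℝ → ℝ)
    (Y : ℝ → Ω → ℝ) (Z : Ω → ℝ) : Prop :=
  AEMeasurable Z P ∧
    ∀ (gm : ℕ → ℝ → ℝ) (I : ℕ → Ω → ℝ), IsContinuousApprox ζ η p a b g gm →
      (∀ m, IsStieltjesIntegral P a b (gm m) Y (I m)) → TendstoInMeasure P I atTop Z

end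

/-! Everything rests on one computation. For a step function `φ`, the integral against `X` is a
combination of independent stable increments, so its characteristic function is `exp (-C |x|^χ
‖φ‖_χ^χ)`, where `‖φ‖_χ` is the Lebesgue `L^χ` norm (`exists_charFun_stepIntegral`). A tail estimate
by characteristic functions turns this into continuity: step functions small in `L^χ` have integrals
small in probability. Since `χ ≥ 1`, `L^χ` is normed, and the integral extends to `L^χ` limits of
step functions; `IsWienerIntegral` is the graph of this extension.

If the increments of `Z` are `∫_s^t h dX` with `|h| ≤ 1`, a Riemann-Stieltjes sum of a continuous
`f` against `Z` is the extended integral of a function that tends to `f * h` in `L^χ`, by uniform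
continuity. Hence `∫ f dZ = ∫ f h dX`. The choice `Z = X`, `h = 1` constructs `Y`; the choice `Z =
Y`, with `h` the weight `ϱ`, gives `∫ f dY = ∫ f ϱ dX`.

Finally `ϱ ≤ 1` and `χ ≥ 1` give `ϱ^χ ≤ ϱ`, so `‖g ϱ‖_χ ≤ ‖g‖_{L^χ(dμ)}`. As `μ` is finite and `p ≥
χ`, this is at most a constant times `‖g‖_{L^p(dμ)}`. Convergence `g_m → g` in `L^p(dμ)` therefore
forces convergence in probability of the integrals to `∫ g ϱ dX`, whatever the sequence. -/

noncomputable section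

/-! ### Step functions and the characteristic functions of their integrals -/

/-- The linear combination `∑ c t * (F t - F 0)` of increments of `F`. -/
def incrementSum (F : ℝ → ℝ) : (ℝ →₀ ℝ) →ₗ[ℝ] ℝ := Finsupp.linearCombination ℝ fun t => F t - F 0

/-- The step function `∑ c t * (1_{(-∞, t]} - 1_{(-∞, 0]})`. -/
def stepFun (c : ℝ →₀ ℝ) (u : ℝ) : ℝ := incrementSum (fun t => (Iic t).indicator 1 u) c

/-- The integral of the step function `stepFun c` against the process `X`. -/
def stepIntegral {Ω : Type*} (X : ℝ → Ω → ℝ) (c : ℝ →₀ ℝ) (ω : Ω) : ℝ :=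
  incrementSum (fun t => X t ω) c

theorem exists_monotone_forall_mem_range (T : Finset ℝ) (hT : T.Nonempty) :
    ∃ (t : ℕ → ℝ) (N : ℕ), Monotone t ∧ ∀ x ∈ T, ∃ k ≤ N, t k = x := by
  have hc : 0 < T.card := hT.card_pos
  -- The `min` keeps the sequence constant after the largest element of `T`.
  refine ⟨fun k => T.orderEmbOfFin rfl ⟨min k (T.card - 1), by omega⟩, T.card, ?_, ?_⟩
  · intro i j hij
    apply (T.orderEmbOfFin rfl).monotone
    simp only [Fin.mk_le_mk]
    omega
  · intro x hx
    have : x ∈ range (T.orderEmbOfFin rfl) := by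
      rw [Finset.range_orderEmbOfFin]; exact hx
    obtain ⟨⟨i, hi⟩, rfl⟩ := this
    refine ⟨i, hi.le, ?_⟩
    simp only [min_eq_left (Nat.le_sub_one_of_lt hi)]

theorem sub_eq_sum_range_ite (F : ℕ → ℝ) {k N : ℕ} (hk : k ≤ N) :
    F k - F 0 = ∑ j ∈ Finset.range N, (if j < k then 1 else 0) * (F (j + 1) - F j) := by
  rw [← Finset.sum_range_sub]
  simp only [ite_mul, one_mul, zero_mul, ← Finset.sum_filter]
  congr 1
  ext j
  simp only [Finset.mem_range, Finset.mem_filter]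
  omega

/-- A linear combination of increments is one of increments over consecutive intervals. -/
theorem exists_incrementSum_eq (c : ℝ →₀ ℝ) :
    ∃ (t : ℕ → ℝ) (N : ℕ) (d : ℕ → ℝ), Monotone t ∧ ∀ F : ℝ → ℝ,
      incrementSum F c = ∑ j ∈ Finset.range N, d j * (F (t (j + 1)) - F (t j)) := by
  obtain ⟨t, N, ht, h⟩ := exists_monotone_forall_mem_range (insert 0 c.support) (by simp)
  choose! k hkN hk using h
  -- Since `0` is a node, `F x - F 0` splits over the intervals between `0` and `x`; the difference
  -- of the two conditions is the sign with which interval `j` enters.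
  refine ⟨t, N, fun j => ∑ x ∈ c.support,
    c x * ((if j < k x then 1 else 0) - (if j < k 0 then 1 else 0)), ht, fun F => ?_⟩
  simp only [incrementSum, Finsupp.linearCombination_apply, Finsupp.sum, smul_eq_mul,
    Finset.sum_mul]
  rw [Finset.sum_comm]
  refine Finset.sum_congr rfl fun x hx => ?_
  have h1 := sub_eq_sum_range_ite (fun j => F (t j)) (hkN x (by simp [hx]))
  have h0 := sub_eq_sum_range_ite (fun j => F (t j)) (hkN 0 (by simp))
  simp only [hk x (Finset.mem_insert_of_mem hx), hk 0 (Finset.mem_insert_self _ _)] at h1 h0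
  have : F x - F 0 = (F x - F (t 0)) - (F 0 - F (t 0)) := by ring
  rw [this, h1, h0, ← Finset.sum_sub_distrib, Finset.mul_sum]
  exact Finset.sum_congr rfl fun j _ => by ring

theorem indicator_Iic_sub_indicator_Iic {s t : ℝ} (hst : s ≤ t) (u : ℝ) :
    (Iic t).indicator (1 : ℝ → ℝ) u - (Iic s).indicator 1 u = (Ioc s t).indicator 1 u := by
  by_cases h1 : u ≤ s
  · simp [indicator, h1, h1.trans hst]
  · by_cases h2 : u ≤ t <;> simp [indicator, h1, h2, not_le.1 h1]

theorem measurable_stepFun (c : ℝ →₀ ℝ) : Measurable (stepFun c) := by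
  obtain ⟨t, N, d, ht, h⟩ := exists_incrementSum_eq c
  have : stepFun c = fun u => ∑ j ∈ Finset.range N, d j *
      ((Ioc (t j) (t (j + 1))).indicator 1 u) := by
    ext u
    rw [stepFun, h]
    exact Finset.sum_congr rfl fun j _ => by
      rw [indicator_Iic_sub_indicator_Iic (ht j.le_succ)]
  rw [this]
  exact Finset.measurable_sum _ fun j _ =>
    (measurable_one.indicator measurableSet_Ioc).const_mul _

/-- The intervals are disjoint, so at each point at most one term survives and the power passes
inside the sum. -/
theorem lintegral_enorm_rpow_sum_indicator_Ioc {t : ℕ → ℝ} (ht : Monotone t) (N : ℕ) (d : ℕ → ℝ)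
    {χ : ℝ} (hχ : 0 < χ) :
    ∫⁻ u, ‖∑ j ∈ Finset.range N, d j * (Ioc (t j) (t (j + 1))).indicator 1 u‖ₑ ^ χ =
      ENNReal.ofReal (∑ j ∈ Finset.range N, |d j| ^ χ * (t (j + 1) - t j)) := by
  have hpt : ∀ u, ‖∑ j ∈ Finset.range N, d j * (Ioc (t j) (t (j + 1))).indicator 1 u‖ₑ ^ χ =
      ∑ j ∈ Finset.range N,
        (Ioc (t j) (t (j + 1))).indicator (fun _ => ENNReal.ofReal (|d j| ^ χ)) u := by
    intro u
    by_cases hu : ∃ i ∈ Finset.range N, u ∈ Ioc (t i) (t (i + 1))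
    · obtain ⟨i, hi, hui⟩ := hu
      have hdis : ∀ j, j ≠ i → u ∉ Ioc (t j) (t (j + 1)) := fun j hj huj =>
        (ht.pairwise_disjoint_on_Ioc_succ hj).le_bot
          ⟨by simpa [Order.succ_eq_add_one] using huj, by simpa [Order.succ_eq_add_one] using hui⟩
      rw [Finset.sum_eq_single_of_mem i hi fun j _ hj => by simp [indicator_of_notMem (hdis j hj)],
        Finset.sum_eq_single_of_mem i hi fun j _ hj => by simp [indicator_of_notMem (hdis j hj)]]
      rw [indicator_of_mem hui, indicator_of_mem hui, Pi.one_apply, mul_one, Real.enorm_eq_ofReal_abs,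
        ENNReal.ofReal_rpow_of_nonneg (abs_nonneg _) hχ.le]
    · push Not at hu
      rw [Finset.sum_eq_zero fun j hj => by simp [indicator_of_notMem (hu j hj)],
        Finset.sum_eq_zero fun j hj => by simp [indicator_of_notMem (hu j hj)]]
      simp [hχ]
  simp_rw [hpt]
  rw [lintegral_finsetSum _ fun j _ => measurable_const.indicator measurableSet_Ioc,
    ENNReal.ofReal_sum_of_nonneg fun j _ =>
      mul_nonneg (by positivity) (sub_nonneg.2 (ht j.le_succ))]
  refine Finset.sum_congr rfl fun j _ => ?_
  rw [lintegral_indicator_const measurableSet_Ioc, Real.volume_Ioc,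
    ENNReal.ofReal_mul (by positivity)]

theorem IsSymmetricStableProcess.measurable_stepIntegral {Ω : Type*} [MeasurableSpace Ω]
    {P : Measure Ω} {χ : ℝ} {X : ℝ → Ω → ℝ} (hX : IsSymmetricStableProcess P χ X) (c : ℝ →₀ ℝ) :
    Measurable (stepIntegral X c) := by
  have : stepIntegral X c = fun ω => ∑ t ∈ c.support, c t * (X t ω - X 0 ω) := by
    ext ω
    simp [stepIntegral, incrementSum, Finsupp.linearCombination_apply, Finsupp.sum]
  rw [this]
  exact Finset.measurable_sum _ fun t _ => ((hX.measurable t).sub (hX.measurable 0)).const_mul _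

theorem charFun_map_const_mul {Ω : Type*} [MeasurableSpace Ω] {P : Measure Ω} {f : Ω → ℝ}
    (hf : Measurable f) (r x : ℝ) :
    charFun (P.map fun ω => r * f ω) x = charFun (P.map f) (x * r) := by
  rw [charFun_apply_real, charFun_apply_real, integral_map (by fun_prop) (by fun_prop),
    integral_map (by fun_prop) (by fun_prop)]
  congr with ω
  push_cast
  ring_nf

/-- The characteristic function of the integral of a step function. -/
theorem IsSymmetricStableProcess.exists_charFun_stepIntegral {Ω : Type*} [MeasurableSpace Ω]
    {P : Measure Ω} [IsProbabilityMeasure P] {χ : ℝ} (hχ : 0 < χ) {X : ℝ → Ω → ℝ}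
    (hX : IsSymmetricStableProcess P χ X) :
    ∃ C : ℝ, 0 < C ∧ ∀ (c : ℝ →₀ ℝ) (x : ℝ),
      eLpNorm (stepFun c) (ENNReal.ofReal χ) volume ≠ ∞ ∧
      charFun (P.map (stepIntegral X c)) x = (Real.exp (-(C *
        (|x| * (eLpNorm (stepFun c) (ENNReal.ofReal χ) volume).toReal) ^ χ)) : ℂ) := by
  obtain ⟨C, hC, hchar⟩ := hX.charFun_eq
  refine ⟨C, hC, fun c x => ?_⟩
  obtain ⟨t, N, d, ht, h⟩ := exists_incrementSum_eq c
  set A := ∑ j ∈ Finset.range N, |d j| ^ χ * (t (j + 1) - t j) with hA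
  have hA0 : 0 ≤ A := Finset.sum_nonneg fun j _ =>
      mul_nonneg (by positivity) (sub_nonneg.2 (ht j.le_succ))
  have hnorm : eLpNorm (stepFun c) (ENNReal.ofReal χ) volume = ENNReal.ofReal (A ^ (1 / χ)) := by
    rw [eLpNorm_eq_lintegral_rpow_enorm_toReal (by simpa using hχ) ENNReal.ofReal_ne_top,
      ENNReal.toReal_ofReal hχ.le, ← ENNReal.ofReal_rpow_of_nonneg hA0 (by positivity), hA,
      ← lintegral_enorm_rpow_sum_indicator_Ioc ht N d hχ]
    congr 2 with u
    rw [stepFun, h]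
    congr 2
    exact Finset.sum_congr rfl fun j _ => by
      rw [indicator_Iic_sub_indicator_Iic (ht j.le_succ)]
  rw [hnorm]
  refine ⟨ENNReal.ofReal_ne_top, ?_⟩
  rw [ENNReal.toReal_ofReal (by positivity), Real.mul_rpow (abs_nonneg _) (by positivity),
    ← Real.rpow_mul hA0, one_div_mul_cancel hχ.ne', Real.rpow_one]
  have hincr : ∀ j, Measurable fun ω => X (t (j + 1)) ω - X (t j) ω := fun j =>
    (hX.measurable _).sub (hX.measurable _)
  have hind : iIndepFun (fun j ω => d j * (X (t (j + 1)) ω - X (t j) ω)) P :=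
    (hX.indep.nat ht).comp (fun j y => d j * y) fun j => measurable_const_mul _
  have hfun : stepIntegral X c =
      fun ω => ∑ j ∈ Finset.range N, d j * (X (t (j + 1)) ω - X (t j) ω) := by
    ext ω
    exact h _
  rw [hfun, iIndepFun.charFun_map_fun_finsetSum_eq_prod
    (fun j _ => ((hincr j).const_mul _).aemeasurable) (hind.restrict _), Finset.prod_apply]
  simp_rw [charFun_map_const_mul (hincr _), hchar _ _ (ht (Nat.le_succ _))]
  rw [← Complex.ofReal_prod, ← Real.exp_sum]
  congr 2
  rw [hA, Finset.mul_sum, Finset.mul_sum, ← Finset.sum_neg_distrib]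
  refine Finset.sum_congr rfl fun j _ => ?_
  rw [abs_mul, Real.mul_rpow (abs_nonneg _) (abs_nonneg _)]
  ring

end

/-! ### Smallness in probability -/

noncomputable section

/-- `P(|f| ≥ ε) ≤ ε`: the random variable `f` has Ky Fan norm at most `ε`. -/
def KyFanLE {Ω : Type*} [MeasurableSpace Ω] (P : Measure Ω) (f : Ω → ℝ) (ε : ℝ≥0∞) : Prop :=
  P {ω | ε ≤ ‖f ω‖ₑ} ≤ ε

section KyFan

variable {Ω : Type*} [MeasurableSpace Ω] {P : Measure Ω} {f g : Ω → ℝ} {ε δ : ℝ≥0∞}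

theorem KyFanLE.mono (hf : KyFanLE P f δ) (h : δ ≤ ε) : KyFanLE P f ε :=
  (measure_mono fun _ hω => h.trans hω).trans (hf.trans h)

theorem KyFanLE.congr_ae (hf : KyFanLE P f ε) (h : f =ᵐ[P] g) : KyFanLE P g ε := by
  refine le_of_eq_of_le (measure_congr ?_) hf
  filter_upwards [h] with ω hω
  rw [eq_iff_iff]
  change ε ≤ ‖g ω‖ₑ ↔ ε ≤ ‖f ω‖ₑ
  rw [hω]

theorem KyFanLE.zero (hε : 0 < ε) : KyFanLE P (fun _ => 0) ε := by
  simp [KyFanLE, hε.not_ge]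

theorem KyFanLE.add (hf : KyFanLE P f (ε / 2)) (hg : KyFanLE P g (ε / 2)) :
    KyFanLE P (fun ω => f ω + g ω) ε := by
  refine (measure_mono (t := {ω | ε / 2 ≤ ‖f ω‖ₑ} ∪ {ω | ε / 2 ≤ ‖g ω‖ₑ}) fun ω hω => ?_).trans
    ((measure_union_le _ _).trans ((add_le_add hf hg).trans (ENNReal.add_halves ε).le))
  by_contra hcon
  simp only [mem_union, mem_ofPred_eq, not_or, not_le] at hcon hω
  exact absurd (hω.trans (enorm_add_le _ _))
    (not_le.2 ((ENNReal.add_lt_add hcon.1 hcon.2).trans_eq (ENNReal.add_halves ε)))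

theorem KyFanLE.neg (hf : KyFanLE P f ε) : KyFanLE P (fun ω => -f ω) ε := by
  simpa [KyFanLE] using hf

theorem KyFanLE.sub (hf : KyFanLE P f (ε / 2)) (hg : KyFanLE P g (ε / 2)) :
    KyFanLE P (fun ω => f ω - g ω) ε := by
  simpa [sub_eq_add_neg] using hf.add hg.neg

/-- The same `ε` bounds both size and probability; dividing by `1 + ‖r‖ₑ` rather than `‖r‖ₑ` keeps
the quotient at most `ε` for small `r` as well. -/
theorem KyFanLE.const_mul (r : ℝ) (hf : KyFanLE P f (ε / (1 + ‖r‖ₑ))) :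
    KyFanLE P (fun ω => r * f ω) ε := by
  have h1 : ε / (1 + ‖r‖ₑ) ≤ ε := ENNReal.div_le_of_le_mul (le_mul_of_one_le_right' le_self_add)
  refine (measure_mono fun ω hω => ?_).trans (hf.trans h1)
  simp only [mem_ofPred_eq, enorm_mul] at hω ⊢
  refine ENNReal.div_le_of_le_mul (hω.trans ?_)
  rw [mul_comm]
  gcongr
  exact le_add_self

theorem tendstoInMeasure_iff_kyFanLE {ι : Type*} {l : Filter ι} {f : ι → Ω → ℝ} {g : Ω → ℝ} :
    TendstoInMeasure P f l g ↔ ∀ ε, 0 < ε → ∀ᶠ i in l, KyFanLE P (fun ω => f i ω - g ω) ε := by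
  simp only [TendstoInMeasure, edist_eq_enorm_sub]
  constructor
  · intro h ε hε
    exact (ENNReal.tendsto_nhds_zero.1 (h ε hε)) ε hε
  · intro h ε hε
    refine ENNReal.tendsto_nhds_zero.2 fun δ hδ => ?_
    filter_upwards [h (min ε δ) (lt_min hε hδ)] with i hi
    exact (measure_mono fun ω hω => (min_le_left ε δ).trans hω).trans (hi.trans (min_le_right ε δ))

/-- A sequence with summable Ky Fan distances converges in probability. -/
theorem exists_tendstoInMeasure_of_kyFanLE_two_inv [IsFiniteMeasure P] {f : ℕ → Ω → ℝ}
    (hf : ∀ n, AEMeasurable (f n) P)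
    (h : ∀ n, KyFanLE P (fun ω => f (n + 1) ω - f n ω) (2⁻¹ ^ n)) :
    ∃ g : Ω → ℝ, Measurable g ∧ TendstoInMeasure P f atTop g := by
  have hsum : ∑' n : ℕ, P {ω | (2⁻¹ : ℝ≥0∞) ^ n ≤ ‖f (n + 1) ω - f n ω‖ₑ} ≠ ∞ := by
    refine ne_top_of_le_ne_top ?_ (ENNReal.tsum_le_tsum h)
    simp [ENNReal.tsum_geometric]
  -- Borel-Cantelli: almost surely the consecutive differences are eventually below a geometric
  -- series.
  have hae : ∀ᵐ ω ∂P, ∃ l : ℝ, Tendsto (fun n => f n ω) atTop (𝓝 l) := by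
    filter_upwards [ae_eventually_notMem hsum] with ω hω
    refine cauchySeq_tendsto_of_complete (cauchySeq_of_summable_dist ?_)
    refine Summable.of_norm_bounded_eventually_nat (g := fun n => (2⁻¹ : ℝ) ^ n)
      (summable_geometric_of_lt_one (by norm_num) (by norm_num)) ?_
    filter_upwards [hω] with n hn
    simp only [not_le] at hn
    rw [Real.norm_of_nonneg dist_nonneg, dist_comm, Real.dist_eq, ← Real.norm_eq_abs,
      ← toReal_enorm]
    have := ENNReal.toReal_mono (by simp) hn.le
    simpa using this
  obtain ⟨g, hg, hlim⟩ := measurable_limit_of_tendsto_metrizable_ae hf hae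
  exact ⟨g, hg, tendstoInMeasure_of_tendsto_ae (fun n => (hf n).aestronglyMeasurable) hlim⟩

end KyFan

section Tail

variable {Ω : Type*} [MeasurableSpace Ω] {P : Measure Ω} [IsProbabilityMeasure P] {χ : ℝ}
  {X : ℝ → Ω → ℝ}

/-- If a step function is small in `L^χ`, then its stochastic integral is small in probability. -/
theorem IsSymmetricStableProcess.exists_kyFanLE_stepIntegral (hχ : 0 < χ)
    (hX : IsSymmetricStableProcess P χ X) {ε : ℝ≥0∞} (hε : 0 < ε) :
    ∃ δ : ℝ≥0∞, 0 < δ ∧ ∀ c : ℝ →₀ ℝ, eLpNorm (stepFun c) (ENNReal.ofReal χ) volume ≤ δ →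
      KyFanLE P (stepIntegral X c) ε := by
  obtain ⟨C, hC, h⟩ := hX.exists_charFun_stepIntegral hχ
  obtain ⟨e, he, heε⟩ : ∃ e : ℝ, 0 < e ∧ ENNReal.ofReal e ≤ ε := by
    refine ⟨(min ε 1).toReal, ENNReal.toReal_pos (by simp [hε.ne']) (by simp), ?_⟩
    rw [ENNReal.ofReal_toReal (by simp)]
    exact min_le_left _ _
  -- The tail estimate concerns a strict inequality; `e ≤ |f|` implies `r < |f|`.
  set r := e / 2 with hr
  have hr0 : 0 < r := by positivity
  -- Chosen so that `C (|x| δ)^χ ≤ e / 2` on the whole range `|x| ≤ 2 / r` of the tail integral.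
  set δ := r / 2 * (e / (2 * C)) ^ (1 / χ) with hδ
  have hδ0 : 0 < δ := by positivity
  refine ⟨ENNReal.ofReal δ, by simpa using hδ0, fun c hc => KyFanLE.mono ?_ heε⟩
  set n := (eLpNorm (stepFun c) (ENNReal.ofReal χ) volume).toReal with hn
  have hnδ : n ≤ δ := ENNReal.toReal_le_of_le_ofReal hδ0.le hc
  have hmeas := hX.measurable_stepIntegral c
  have : IsProbabilityMeasure (P.map (stepIntegral X c)) :=
    Measure.isProbabilityMeasure_map hmeas.aemeasurable
  have hbound : ‖∫ x in (-2 * r⁻¹)..(2 * r⁻¹), 1 - charFun (P.map (stepIntegral X c)) x‖ ≤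
      e / 2 * |2 * r⁻¹ - -2 * r⁻¹| := by
    refine intervalIntegral.norm_integral_le_of_norm_le_const fun x hx => ?_
    rw [uIoc_of_le (by have := inv_pos.2 hr0; linarith)] at hx
    have hx' : |x| ≤ 2 * r⁻¹ := abs_le.2 ⟨by linarith [hx.1], hx.2⟩
    rw [(h c x).2, ← Complex.ofReal_one, ← Complex.ofReal_sub, Complex.norm_real, Real.norm_eq_abs]
    have h1 : (|x| * n) ^ χ ≤ e / (2 * C) := by
      calc (|x| * n) ^ χ ≤ (2 * r⁻¹ * δ) ^ χ := by
            have : 0 ≤ n := ENNReal.toReal_nonneg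
            gcongr
        _ = ((e / (2 * C)) ^ (1 / χ)) ^ χ := by
            congr 1
            rw [hδ]
            field_simp
        _ = e / (2 * C) := by
            rw [← Real.rpow_mul (by positivity), one_div_mul_cancel hχ.ne', Real.rpow_one]
    have h2 : C * (|x| * n) ^ χ ≤ e / 2 := by
      calc C * (|x| * n) ^ χ ≤ C * (e / (2 * C)) := by gcongr
        _ = e / 2 := by field_simp
    have h3 : 0 ≤ C * (|x| * n) ^ χ := by positivity
    have h4 := Real.add_one_le_exp (-(C * (|x| * n) ^ χ))
    have h5 : Real.exp (-(C * (|x| * n) ^ χ)) ≤ 1 := Real.exp_le_one_iff.2 (by linarith)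
    rw [abs_of_nonneg (by linarith)]
    linarith
  -- The factor `r / 2`, the interval length `4 / r` and the bound `e / 2` on the integrand multiply
  -- to `e`.
  have htail := measureReal_abs_gt_le_integral_charFun (μ := P.map (stepIntegral X c)) hr0
  have hle : P.real {ω | r < |stepIntegral X c ω|} ≤ e := by
    rw [map_measureReal_apply hmeas (measurableSet_lt measurable_const continuous_abs.measurable)] at htail
    refine (htail.trans (mul_le_mul_of_nonneg_left hbound (by positivity))).trans ?_
    rw [abs_of_nonneg (by have := inv_pos.2 hr0; linarith)]
    apply le_of_eq
    field_simp
    ring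
  unfold KyFanLE
  calc P {ω | ENNReal.ofReal e ≤ ‖stepIntegral X c ω‖ₑ}
      ≤ P {ω | r < |stepIntegral X c ω|} := measure_mono fun ω hω => by
        simp only [mem_ofPred_eq, Real.enorm_eq_ofReal_abs] at hω ⊢
        have := (ENNReal.ofReal_le_ofReal_iff (abs_nonneg _)).1 hω
        linarith
    _ ≤ ENNReal.ofReal e := by
        rw [← ofReal_measureReal]
        exact ENNReal.ofReal_le_ofReal hle

end Tail

end

/-! ### The integral extended from step functions by closure -/

noncomputable section

/-- The random variable `I` is the integral of `φ` against the process `X`, in the sense that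
`(φ, I)` is a limit, in `L^q` and in probability, of step functions and their integrals. -/
structure IsWienerIntegral {Ω : Type*} [MeasurableSpace Ω] (P : Measure Ω) (q : ℝ≥0∞)
    (X : ℝ → Ω → ℝ) (φ : ℝ → ℝ) (I : Ω → ℝ) : Prop where
  aestronglyMeasurable : AEStronglyMeasurable φ volume
  aemeasurable : AEMeasurable I P
  approx : ∀ ε, 0 < ε → ∃ c, eLpNorm (fun u => stepFun c u - φ u) q volume ≤ ε ∧
    KyFanLE P (fun ω => stepIntegral X c ω - I ω) ε

namespace IsWienerIntegral

variable {Ω : Type*} [MeasurableSpace Ω] {P : Measure Ω} {q : ℝ≥0∞} {X : ℝ → Ω → ℝ}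
  {φ ψ : ℝ → ℝ} {I J : Ω → ℝ}

theorem congr_ae (h : IsWienerIntegral P q X φ I) (hIJ : I =ᵐ[P] J) :
    IsWienerIntegral P q X φ J where
  aestronglyMeasurable := h.aestronglyMeasurable
  aemeasurable := h.aemeasurable.congr hIJ
  approx ε hε := by
    obtain ⟨c, h1, h2⟩ := h.approx ε hε
    refine ⟨c, h1, h2.congr_ae ?_⟩
    filter_upwards [hIJ] with ω hω
    rw [hω]

theorem step (hX : ∀ c, Measurable (stepIntegral X c)) (c : ℝ →₀ ℝ) :
    IsWienerIntegral P q X (stepFun c) (stepIntegral X c) where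
  aestronglyMeasurable := (measurable_stepFun c).aestronglyMeasurable
  aemeasurable := (hX c).aemeasurable
  approx ε hε := ⟨c, by simp, by simpa using KyFanLE.zero hε⟩

theorem increment (hX : ∀ c, Measurable (stepIntegral X c)) {s t : ℝ} (hst : s ≤ t) :
    IsWienerIntegral P q X ((Ioc s t).indicator 1) (fun ω => X t ω - X s ω) := by
  have key : ∀ F : ℝ → ℝ,
      incrementSum F (Finsupp.single t 1 - Finsupp.single s 1) = F t - F s := by
    intro F
    simp [incrementSum, map_sub]
  convert step hX (Finsupp.single t 1 - Finsupp.single s 1) using 1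
  · ext u
    rw [stepFun, key, indicator_Iic_sub_indicator_Iic hst]
  · ext ω
    rw [stepIntegral, key]

theorem zero (hX : ∀ c, Measurable (stepIntegral X c)) :
    IsWienerIntegral P q X (fun _ => 0) (fun _ => 0) := by
  convert step hX 0 using 1
  · ext u
    simp [stepFun]
  · ext ω
    simp [stepIntegral]

theorem add (hq : 1 ≤ q) (h : IsWienerIntegral P q X φ I) (h' : IsWienerIntegral P q X ψ J) :
    IsWienerIntegral P q X (fun u => φ u + ψ u) (fun ω => I ω + J ω) where
  aestronglyMeasurable := h.aestronglyMeasurable.add h'.aestronglyMeasurable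
  aemeasurable := h.aemeasurable.add h'.aemeasurable
  approx ε hε := by
    obtain ⟨c, h1, h2⟩ := h.approx _ (ENNReal.half_pos hε.ne')
    obtain ⟨c', h1', h2'⟩ := h'.approx _ (ENNReal.half_pos hε.ne')
    refine ⟨c + c', ?_, ?_⟩
    · have : (fun u => stepFun (c + c') u - (φ u + ψ u)) =
          (fun u => stepFun c u - φ u) + fun u => stepFun c' u - ψ u := by
        ext u
        simp only [stepFun, map_add, Pi.add_apply]
        ring
      rw [this]
      exact (eLpNorm_add_le ((measurable_stepFun c).aestronglyMeasurable.sub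
        h.aestronglyMeasurable) ((measurable_stepFun c').aestronglyMeasurable.sub
        h'.aestronglyMeasurable) hq).trans ((add_le_add h1 h1').trans (ENNReal.add_halves ε).le)
    · convert h2.add h2' using 2 with ω
      simp only [stepIntegral, map_add]
      ring

theorem const_mul (r : ℝ) (h : IsWienerIntegral P q X φ I) :
    IsWienerIntegral P q X (fun u => r * φ u) (fun ω => r * I ω) where
  aestronglyMeasurable := h.aestronglyMeasurable.const_mul r
  aemeasurable := h.aemeasurable.const_mul r
  approx ε hε := by
    obtain ⟨c, h1, h2⟩ := h.approx (ε / (1 + ‖r‖ₑ)) (ENNReal.div_pos hε.ne' (by simp))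
    refine ⟨r • c, ?_, ?_⟩
    · have : (fun u => stepFun (r • c) u - r * φ u) = r • fun u => stepFun c u - φ u := by
        ext u
        simp only [stepFun, map_smul, Pi.smul_apply, smul_eq_mul]
        ring
      rw [this, eLpNorm_const_smul]
      calc ‖r‖ₑ * eLpNorm (fun u => stepFun c u - φ u) q volume
          ≤ (1 + ‖r‖ₑ) * (ε / (1 + ‖r‖ₑ)) := by
            gcongr
            exact le_add_self
        _ ≤ ε := ENNReal.mul_div_le
    · convert h2.const_mul r using 2 with ω
      simp only [stepIntegral, map_smul, smul_eq_mul]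
      ring

theorem sub (hq : 1 ≤ q) (h : IsWienerIntegral P q X φ I) (h' : IsWienerIntegral P q X ψ J) :
    IsWienerIntegral P q X (fun u => φ u - ψ u) (fun ω => I ω - J ω) := by
  convert h.add hq (h'.const_mul (-1)) using 2 <;> ring

theorem sum (hq : 1 ≤ q) (hX : ∀ c, Measurable (stepIntegral X c)) {ι : Type*} (s : Finset ι)
    {φ : ι → ℝ → ℝ} {I : ι → Ω → ℝ} (h : ∀ i ∈ s, IsWienerIntegral P q X (φ i) (I i)) :
    IsWienerIntegral P q X (fun u => ∑ i ∈ s, φ i u) (fun ω => ∑ i ∈ s, I i ω) := by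
  classical
  induction s using Finset.induction_on with
  | empty => simpa using zero hX
  | insert i s hi ih =>
    simp only [Finset.sum_insert hi]
    exact (h i (by simp)).add hq (ih fun j hj => h j (by simp [hj]))

/-- The closedness of the integral: limits of integrands and integrals correspond. -/
theorem of_tendsto (hq : 1 ≤ q) {ι : Type*} {l : Filter ι} [l.NeBot] {f : ι → ℝ → ℝ}
    {K : ι → Ω → ℝ} (h : ∀ i, IsWienerIntegral P q X (f i) (K i))
    (hφ : AEStronglyMeasurable φ volume) (hI : AEMeasurable I P)
    (hf : Tendsto (fun i => eLpNorm (fun u => f i u - φ u) q volume) l (𝓝 0))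
    (hK : TendstoInMeasure P K l I) : IsWienerIntegral P q X φ I where
  aestronglyMeasurable := hφ
  aemeasurable := hI
  approx ε hε := by
    have hε2 := ENNReal.half_pos hε.ne'
    obtain ⟨i, hi1, hi2⟩ := ((ENNReal.tendsto_nhds_zero.1 hf _ hε2).and
      (tendstoInMeasure_iff_kyFanLE.1 hK _ hε2)).exists
    obtain ⟨c, h1, h2⟩ := (h i).approx _ hε2
    refine ⟨c, ?_, ?_⟩
    · have : (fun u => stepFun c u - φ u) =
          (fun u => stepFun c u - f i u) + fun u => f i u - φ u := by
        ext u
        simp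
      rw [this]
      exact (eLpNorm_add_le ((measurable_stepFun c).aestronglyMeasurable.sub
        (h i).aestronglyMeasurable) ((h i).aestronglyMeasurable.sub hφ) hq).trans
        ((add_le_add h1 hi1).trans (ENNReal.add_halves ε).le)
    · convert h2.add hi2 using 2 with ω
      ring

variable {χ : ℝ} [IsProbabilityMeasure P]

/-- If an integrand is small in `L^χ`, then its integral is small in probability. -/
theorem exists_kyFanLE (hχ : 1 ≤ χ) (hX : IsSymmetricStableProcess P χ X) {ε : ℝ≥0∞}
    (hε : 0 < ε) : ∃ δ : ℝ≥0∞, 0 < δ ∧ ∀ (φ : ℝ → ℝ) (I : Ω → ℝ),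
      IsWienerIntegral P (ENNReal.ofReal χ) X φ I → eLpNorm φ (ENNReal.ofReal χ) volume ≤ δ →
        KyFanLE P I ε := by
  have hε2 := ENNReal.half_pos hε.ne'
  obtain ⟨δ, hδ, hstep⟩ := hX.exists_kyFanLE_stepIntegral (by linarith) hε2
  have hδ2 := ENNReal.half_pos hδ.ne'
  refine ⟨δ / 2, hδ2, fun φ I h hφ => ?_⟩
  obtain ⟨c, h1, h2⟩ := h.approx (min (δ / 2) (ε / 2)) (lt_min hδ2 hε2)
  have hc : eLpNorm (stepFun c) (ENNReal.ofReal χ) volume ≤ δ := by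
    have : stepFun c = (fun u => stepFun c u - φ u) + φ := by
      ext u
      simp
    rw [this]
    exact (eLpNorm_add_le ((measurable_stepFun c).aestronglyMeasurable.sub
      h.aestronglyMeasurable) h.aestronglyMeasurable (by simpa using hχ)).trans
      ((add_le_add (h1.trans (min_le_left _ _)) hφ).trans (ENNReal.add_halves δ).le)
  convert (hstep c hc).sub (h2.mono (min_le_right _ _)) using 2 with ω
  ring

theorem tendstoInMeasure (hχ : 1 ≤ χ) (hX : IsSymmetricStableProcess P χ X) {ι : Type*}
    {l : Filter ι} {f : ι → ℝ → ℝ} {K : ι → Ω → ℝ}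
    (h : ∀ i, IsWienerIntegral P (ENNReal.ofReal χ) X (f i) (K i))
    (hI : IsWienerIntegral P (ENNReal.ofReal χ) X φ I)
    (hf : Tendsto (fun i => eLpNorm (fun u => f i u - φ u) (ENNReal.ofReal χ) volume) l (𝓝 0)) :
    TendstoInMeasure P K l I := by
  refine tendstoInMeasure_iff_kyFanLE.2 fun ε hε => ?_
  obtain ⟨δ, hδ, hδε⟩ := exists_kyFanLE hχ hX hε
  filter_upwards [ENNReal.tendsto_nhds_zero.1 hf δ hδ] with i hi
  exact hδε _ _ ((h i).sub (by simpa using hχ) hI) hi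

/-- The `L^χ`-limit of integrands that have integrals has one, and the integrals converge. -/
theorem exists_tendstoInMeasure (hχ : 1 ≤ χ) (hX : IsSymmetricStableProcess P χ X) {ι : Type*}
    {l : Filter ι} [l.NeBot] {f : ι → ℝ → ℝ} {K : ι → Ω → ℝ}
    (h : ∀ i, IsWienerIntegral P (ENNReal.ofReal χ) X (f i) (K i))
    (hφ : AEStronglyMeasurable φ volume)
    (hf : Tendsto (fun i => eLpNorm (fun u => f i u - φ u) (ENNReal.ofReal χ) volume) l (𝓝 0)) :
    ∃ I, IsWienerIntegral P (ENNReal.ofReal χ) X φ I ∧ TendstoInMeasure P K l I := by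
  have hq : 1 ≤ ENNReal.ofReal χ := by simpa using hχ
  have hpos : ∀ n : ℕ, (0 : ℝ≥0∞) < 2⁻¹ ^ n := fun n => ENNReal.pow_pos (by simp) n
  choose δ hδ hδK using fun n => exists_kyFanLE hχ hX (hpos n)
  -- The `n`-th integrand is compared with its successor, within `δ n`, and with its predecessor,
  -- within `δ (n - 1)`; each gets half the tolerance. The last term makes the chosen integrands
  -- converge. At `n = 0` the truncated index is harmless.
  have hθ : ∀ n, 0 < min (min (δ n / 2) (δ (n - 1) / 2)) (2⁻¹ ^ n) := fun n =>
    lt_min (lt_min (ENNReal.half_pos (hδ n).ne') (ENNReal.half_pos (hδ _).ne')) (hpos n)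
  choose k hk using fun n => (ENNReal.tendsto_nhds_zero.1 hf _ (hθ n)).exists
  have hstep : ∀ n, KyFanLE P (fun ω => K (k (n + 1)) ω - K (k n) ω) (2⁻¹ ^ n) := by
    intro n
    refine hδK n _ _ ((h _).sub hq (h _)) ?_
    have : (fun u => f (k (n + 1)) u - f (k n) u) =
        (fun u => f (k (n + 1)) u - φ u) - fun u => f (k n) u - φ u := by
      ext u
      simp
    rw [this]
    refine (eLpNorm_sub_le ((h _).aestronglyMeasurable.sub hφ)
      ((h _).aestronglyMeasurable.sub hφ) hq).trans ?_
    refine (add_le_add ((hk (n + 1)).trans ?_) ((hk n).trans ?_)).trans (ENNReal.add_halves _).le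
    · exact (min_le_left _ _).trans (min_le_right _ _)
    · exact (min_le_left _ _).trans (min_le_left _ _)
  obtain ⟨I, hI, hlim⟩ :=
    exists_tendstoInMeasure_of_kyFanLE_two_inv (fun n => (h (k n)).aemeasurable) hstep
  have hfk : Tendsto (fun n => eLpNorm (fun u => f (k n) u - φ u) (ENNReal.ofReal χ) volume) atTop
      (𝓝 0) := by
    refine tendsto_of_tendsto_of_tendsto_of_le_of_le tendsto_const_nhds
      (ENNReal.tendsto_pow_atTop_nhds_zero_of_lt_one (r := 2⁻¹) (by simp)) (fun _ => zero_le)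
      fun n => (hk n).trans (min_le_right _ _)
  -- The limit of the chosen sequence is an integral of `φ`, so continuity then gives convergence
  -- along all of `l`.
  have hWI := of_tendsto hq (fun n => h (k n)) hφ hI.aemeasurable hfk hlim
  exact ⟨I, hWI, tendstoInMeasure hχ hX h hWI hf⟩

end IsWienerIntegral

end

/-! ### Tagged partitions and convergence of the Riemann-Stieltjes integrands -/

noncomputable section

namespace TaggedPartition

variable {a b : ℝ}

theorem sub_le_mesh (π : TaggedPartition a b) {i : ℕ} (hi : i < π.size) :
    π.point (i + 1) - π.point i ≤ π.mesh :=
  le_ciSup (f := fun i : Fin π.size => π.point (i + 1) - π.point i)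
    (Finite.bddAbove_range _) ⟨i, hi⟩

theorem le_point (π : TaggedPartition a b) (i : ℕ) : a ≤ π.point i :=
  π.point_zero.symm.le.trans (π.point_mono i.zero_le)

theorem point_le (π : TaggedPartition a b) {i : ℕ} (hi : i ≤ π.size) : π.point i ≤ b :=
  (π.point_mono hi).trans π.point_size.le

theorem tag_mem_Icc (π : TaggedPartition a b) {i : ℕ} (hi : i < π.size) : π.tag i ∈ Icc a b :=
  ⟨(π.le_point i).trans (π.tag_mem i hi).1, (π.tag_mem i hi).2.trans (π.point_le hi)⟩

theorem exists_mem_Ioc (π : TaggedPartition a b) {u : ℝ} (hu : u ∈ Ioc a b) :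
    ∃ i < π.size, u ∈ Ioc (π.point i) (π.point (i + 1)) := by
  classical
  -- The first partition point not to the left of `u` is the right endpoint sought; this choice
  -- skips degenerate intervals.
  have hex : ∃ k, u ≤ π.point k := ⟨π.size, by rw [π.point_size]; exact hu.2⟩
  have h0 : Nat.find hex ≠ 0 := by
    intro h
    have := Nat.find_spec hex
    rw [h, π.point_zero] at this
    exact absurd hu.1 this.not_gt
  obtain ⟨i, hi⟩ := Nat.exists_eq_succ_of_ne_zero h0
  have hle : Nat.find hex ≤ π.size := Nat.find_min' hex (by rw [π.point_size]; exact hu.2)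
  refine ⟨i, by omega, not_le.1 (Nat.find_min hex (by omega)), ?_⟩
  have := Nat.find_spec hex
  rwa [hi] at this

theorem sum_indicator_eq (π : TaggedPartition a b) (f h : ℝ → ℝ) {i : ℕ} (hi : i < π.size) {u : ℝ}
    (hu : u ∈ Ioc (π.point i) (π.point (i + 1))) :
    ∑ j ∈ Finset.range π.size,
      f (π.tag j) * (Ioc (π.point j) (π.point (j + 1))).indicator h u = f (π.tag i) * h u := by
  rw [Finset.sum_eq_single_of_mem i (Finset.mem_range.2 hi), indicator_of_mem hu]
  intro j _ hj
  have : u ∉ Ioc (π.point j) (π.point (j + 1)) := fun huj =>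
    (π.point_mono.pairwise_disjoint_on_Ioc_succ hj).le_bot
      ⟨by simpa [Order.succ_eq_add_one] using huj, by simpa [Order.succ_eq_add_one] using hu⟩
  simp [indicator_of_notMem this]

/-- The partition of `[a, b]` into `n + 1` equal intervals, tagged by their left endpoints. -/
def uniform (hab : a ≤ b) (n : ℕ) : TaggedPartition a b where
  size := n + 1
  point i := a + (b - a) * ((min i (n + 1) : ℕ) / (n + 1 : ℝ))
  tag i := a + (b - a) * ((min i (n + 1) : ℕ) / (n + 1 : ℝ))
  point_mono i j hij := by
    have : 0 ≤ b - a := sub_nonneg.2 hab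
    dsimp only
    gcongr
  point_zero := by simp
  point_size := by
    have : (n + 1 : ℝ) ≠ 0 := by positivity
    simp [div_self this]
  tag_mem i _ := by
    have : 0 ≤ b - a := sub_nonneg.2 hab
    refine ⟨le_rfl, ?_⟩
    gcongr
    omega

theorem mesh_uniform (hab : a ≤ b) (n : ℕ) : (uniform hab n).mesh = (b - a) / (n + 1) := by
  have h : ∀ i : Fin (n + 1), (uniform hab n).point (i + 1) - (uniform hab n).point i =
      (b - a) / (n + 1) := by
    intro i
    have h1 : min (i : ℕ) (n + 1) = i := by omega
    have h2 : min ((i : ℕ) + 1) (n + 1) = i + 1 := by omega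
    simp only [uniform, h1, h2]
    push_cast
    field_simp
    ring
  exact (iSup_congr h).trans ciSup_const

/-- Limits along this filter are not vacuous; both their existence and their uniqueness need this.
-/
theorem meshToZero_neBot (hab : a ≤ b) : (meshToZero a b).NeBot := by
  have : Tendsto (uniform hab) atTop (meshToZero a b) := by
    refine tendsto_comap_iff.2 ?_
    have : mesh ∘ uniform hab = fun n : ℕ => (b - a) * (1 / ((n : ℝ) + 1)) := by
      ext n
      simp [mesh_uniform, div_eq_mul_inv]
    rw [this]
    simpa using tendsto_one_div_add_atTop_nhds_zero_nat.const_mul (b - a)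
  exact this.neBot

/-- Needed for the almost sure uniqueness of limits in probability, which passes through a sequence.
-/
instance : (meshToZero a b).IsCountablyGenerated := by
  unfold meshToZero
  infer_instance

theorem eventually_mesh_lt {δ : ℝ} (hδ : 0 < δ) : ∀ᶠ π in meshToZero a b, π.mesh < δ :=
  tendsto_comap.eventually (gt_mem_nhds hδ)

/-- The Riemann-Stieltjes integrands converge to the integrand in `L^q`. -/
theorem tendsto_eLpNorm_sum_indicator_sub {f h : ℝ → ℝ} (hf : ContinuousOn f (Icc a b))
    (hh : ∀ u ∈ Icc a b, |h u| ≤ 1) (q : ℝ≥0∞) :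
    Tendsto (fun π : TaggedPartition a b => eLpNorm (fun u => ∑ j ∈ Finset.range π.size,
      f (π.tag j) * (Ioc (π.point j) (π.point (j + 1))).indicator h u -
        (Ioc a b).indicator (fun u => f u * h u) u) q volume) (meshToZero a b) (𝓝 0) := by
  set M := eLpNorm ((Ioc a b).indicator (1 : ℝ → ℝ)) q volume with hM
  have hMtop : M ≠ ∞ :=
    (memLp_indicator_const q measurableSet_Ioc (1 : ℝ) (Or.inr (by simp))).eLpNorm_ne_top
  refine ENNReal.tendsto_nhds_zero.2 fun η hη => ?_
  obtain ⟨e, he, heη⟩ : ∃ e : ℝ, 0 < e ∧ ENNReal.ofReal e ≤ η / (M + 1) := by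
    have hpos : 0 < η / (M + 1) := ENNReal.div_pos hη.ne' (by simp [hMtop])
    refine ⟨(min (η / (M + 1)) 1).toReal, ENNReal.toReal_pos (by simp [hpos.ne']) (by simp), ?_⟩
    rw [ENNReal.ofReal_toReal (by simp)]
    exact min_le_left _ _
  obtain ⟨δ, hδ, hfδ⟩ := Metric.uniformContinuousOn_iff.1
    (isCompact_Icc.uniformContinuousOn_of_continuous hf) e he
  filter_upwards [eventually_mesh_lt hδ] with π hπ
  -- Only the interval containing `u` contributes, and its tag is within the mesh of `u`; uniform
  -- continuity and `|h| ≤ 1` bound the error by `e`.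
  have hpt : ∀ u, ‖∑ j ∈ Finset.range π.size,
      f (π.tag j) * (Ioc (π.point j) (π.point (j + 1))).indicator h u -
        (Ioc a b).indicator (fun u => f u * h u) u‖ ≤ e * ‖(Ioc a b).indicator (1 : ℝ → ℝ) u‖ := by
    intro u
    by_cases hu : u ∈ Ioc a b
    · obtain ⟨i, hi, hui⟩ := π.exists_mem_Ioc hu
      have htag := π.tag_mem i hi
      have hdist : dist (π.tag i) u < δ := by
        refine lt_of_le_of_lt ?_ ((π.sub_le_mesh hi).trans_lt hπ)
        rw [Real.dist_eq, abs_le]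
        constructor <;> linarith [htag.1, htag.2, hui.1, hui.2]
      have hfe := hfδ _ (π.tag_mem_Icc hi) u (Ioc_subset_Icc_self hu) hdist
      rw [π.sum_indicator_eq f h hi hui, indicator_of_mem hu, indicator_of_mem hu, ← sub_mul,
        norm_mul, Pi.one_apply, norm_one]
      rw [Real.dist_eq] at hfe
      exact mul_le_mul hfe.le (hh u (Ioc_subset_Icc_self hu)) (norm_nonneg _) he.le
    · rw [indicator_of_notMem hu, Finset.sum_eq_zero, indicator_of_notMem hu]
      · simp
      · intro j hj
        rw [indicator_of_notMem, mul_zero]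
        exact fun huj => hu ⟨(π.le_point j).trans_lt huj.1,
          huj.2.trans (π.point_le (Finset.mem_range.1 hj))⟩
  calc _ ≤ ENNReal.ofReal e * M := eLpNorm_le_mul_eLpNorm_of_ae_le_mul (ae_of_all _ hpt) q
    _ ≤ η / (M + 1) * (M + 1) := mul_le_mul' heη le_self_add
    _ ≤ η := (mul_comm _ _).le.trans ENNReal.mul_div_le

end TaggedPartition

/-! ### Stieltjes integrals of continuous functions -/

section Stieltjes

variable {Ω : Type*} [MeasurableSpace Ω] {P : Measure Ω} {χ a b : ℝ} {X Z : ℝ → Ω → ℝ}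
  {f h : ℝ → ℝ} {I J : Ω → ℝ}

theorem IsStieltjesIntegral.ae_eq (hab : a ≤ b) (hI : IsStieltjesIntegral P a b f Z I)
    (hJ : IsStieltjesIntegral P a b f Z J) : I =ᵐ[P] J := by
  have := TaggedPartition.meshToZero_neBot hab
  exact tendstoInMeasure_ae_unique hI.2 hJ.2

/-- A continuous function has a Stieltjes integral against a process with increments
`Z t - Z s = ∫_s^t h dX`, and it is the integral of `f * h` against `X`. -/
theorem exists_isWienerIntegral_and_isStieltjesIntegral [IsProbabilityMeasure P] (hχ : 1 ≤ χ)
    (hX : IsSymmetricStableProcess P χ X) (hab : a ≤ b) (hhm : Measurable h)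
    (hh : ∀ u ∈ Icc a b, |h u| ≤ 1)
    (hZ : ∀ s t, a ≤ s → s ≤ t → t ≤ b → IsWienerIntegral P (ENNReal.ofReal χ) X
      ((Ioc s t).indicator h) (fun ω => Z t ω - Z s ω))
    (hf : ContinuousOn f (Icc a b)) :
    ∃ I, IsWienerIntegral P (ENNReal.ofReal χ) X ((Ioc a b).indicator fun u => f u * h u) I ∧
      IsStieltjesIntegral P a b f Z I := by
  have := TaggedPartition.meshToZero_neBot hab
  have hmeas : AEStronglyMeasurable ((Ioc a b).indicator fun u => f u * h u) volume :=
    (aestronglyMeasurable_indicator_iff measurableSet_Ioc).2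
      (((hf.mono Ioc_subset_Icc_self).aestronglyMeasurable measurableSet_Ioc).mul
        hhm.aestronglyMeasurable)
  have hπ : ∀ π : TaggedPartition a b, IsWienerIntegral P (ENNReal.ofReal χ) X
      (fun u => ∑ j ∈ Finset.range π.size,
        f (π.tag j) * (Ioc (π.point j) (π.point (j + 1))).indicator h u) (π.sum f Z) := fun π =>
    IsWienerIntegral.sum (by simpa using hχ) hX.measurable_stepIntegral _ fun j hj =>
      (hZ _ _ (π.le_point j) (π.point_mono j.le_succ)
        (π.point_le (Finset.mem_range.1 hj))).const_mul _
  obtain ⟨I, hI, hlim⟩ := IsWienerIntegral.exists_tendstoInMeasure hχ hX hπ hmeas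
    (TaggedPartition.tendsto_eLpNorm_sum_indicator_sub hf hh _)
  exact ⟨I, hI, hI.aemeasurable, hlim⟩

end Stieltjes

/-! ### The weight and its norm inequality -/

section Jacobi

variable {ζ η a b : ℝ}

theorem continuous_jacobiWeight (hζ : 0 ≤ ζ) (hη : 0 ≤ η) : Continuous (jacobiWeight ζ η) :=
  ((Real.continuous_rpow_const hζ).comp (continuous_const.sub continuous_id)).mul
    ((Real.continuous_rpow_const hη).comp (continuous_const.add continuous_id))

theorem jacobiWeight_nonneg (ha : -1 ≤ a) (hb : b ≤ 1) {v : ℝ} (hv : v ∈ Icc a b) :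
    0 ≤ jacobiWeight ζ η v :=
  mul_nonneg (Real.rpow_nonneg (by linarith [hv.2]) _) (Real.rpow_nonneg (by linarith [hv.1]) _)

theorem jacobiMeasure_restrict_Icc (ha : -1 ≤ a) (hb : b ≤ 1) :
    (jacobiMeasure ζ η).restrict (Icc a b) =
      (volume.restrict (Icc a b)).withDensity fun u => ENNReal.ofReal (jacobiWeight ζ η u) := by
  rw [jacobiMeasure, restrict_withDensity measurableSet_Icc,
    Measure.restrict_restrict measurableSet_Icc, inter_eq_left.2 (Icc_subset_Icc ha hb)]

theorem isFiniteMeasure_jacobiMeasure_restrict_Icc (hζ : 0 ≤ ζ) (hη : 0 ≤ η) (ha : -1 ≤ a)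
    (hb : b ≤ 1) : IsFiniteMeasure ((jacobiMeasure ζ η).restrict (Icc a b)) := by
  rw [jacobiMeasure_restrict_Icc ha hb]
  exact isFiniteMeasure_withDensity_ofReal
    ((continuous_jacobiWeight hζ hη).continuousOn.integrableOn_compact isCompact_Icc).2

theorem aestronglyMeasurable_indicator_mul_jacobiWeight (hζ : 0 ≤ ζ) (hη : 0 ≤ η) (ha : -1 ≤ a)
    (hb : b ≤ 1) {g : ℝ → ℝ}
    (hg : AEStronglyMeasurable g ((jacobiMeasure ζ η).restrict (Icc a b))) :
    AEStronglyMeasurable ((Ioc a b).indicator fun u => g u * jacobiWeight ζ η u) volume := by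
  rw [jacobiMeasure_restrict_Icc ha hb] at hg
  have h := (aestronglyMeasurable_withDensity_iff
    (continuous_jacobiWeight hζ hη).measurable.real_toNNReal).1 hg
  refine (aestronglyMeasurable_indicator_iff measurableSet_Ioc).2
    ((h.mono_measure (Measure.restrict_mono Ioc_subset_Icc_self le_rfl)).congr ?_)
  filter_upwards [ae_restrict_mem measurableSet_Ioc] with u hu
  rw [Real.coe_toNNReal _ (jacobiWeight_nonneg ha hb (Ioc_subset_Icc_self hu)), smul_eq_mul,
    mul_comm]

/-- Where the weight is at most `1`, multiplication by the weight is a contraction from the weighted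
space `L^χ` to the unweighted one. -/
theorem eLpNorm_indicator_mul_jacobiWeight_le (hζ : 0 ≤ ζ) (hη : 0 ≤ η) (ha : -1 ≤ a) (hb : b ≤ 1)
    (hw : ∀ v ∈ Icc a b, jacobiWeight ζ η v ≤ 1) {χ : ℝ} (hχ : 1 ≤ χ) (k : ℝ → ℝ) :
    eLpNorm ((Ioc a b).indicator fun u => k u * jacobiWeight ζ η u) (ENNReal.ofReal χ) volume ≤
      eLpNorm k (ENNReal.ofReal χ) ((jacobiMeasure ζ η).restrict (Icc a b)) := by
  have hχ0 : 0 < χ := by linarith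
  rw [jacobiMeasure_restrict_Icc ha hb, eLpNorm_indicator_eq_eLpNorm_restrict measurableSet_Ioc,
    eLpNorm_eq_lintegral_rpow_enorm_toReal (by simpa using hχ0) ENNReal.ofReal_ne_top,
    eLpNorm_eq_lintegral_rpow_enorm_toReal (by simpa using hχ0) ENNReal.ofReal_ne_top,
    ENNReal.toReal_ofReal hχ0.le,
    lintegral_withDensity_eq_lintegral_mul_non_measurable _
      (continuous_jacobiWeight hζ hη).measurable.ennreal_ofReal (by simp)]
  gcongr ?_ ^ _
  refine (lintegral_mono_set Ioc_subset_Icc_self).trans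
    (setLIntegral_mono' measurableSet_Icc fun u hu => ?_)
  have h0 := jacobiWeight_nonneg (ζ := ζ) (η := η) ha hb hu
  rw [enorm_mul, ENNReal.mul_rpow_of_nonneg _ _ hχ0.le, mul_comm, Pi.mul_apply,
    Real.enorm_of_nonneg h0]
  gcongr
  -- This is `ϱ^χ ≤ ϱ`, where the bound on the weight and `χ ≥ 1` enter.
  exact ENNReal.rpow_le_self_of_le_one (by simpa using hw u hu) hχ

end Jacobi

end

/-! ### The process `Y` and its integrals -/

section JacobiProcess

variable {Ω : Type*} [MeasurableSpace Ω] {P : Measure Ω} [IsProbabilityMeasure P]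
  {χ p ζ η a b : ℝ} {X Y : ℝ → Ω → ℝ}

theorem exists_isWienerIntegral_jacobiWeight (hχ : 1 ≤ χ) (hζ : 0 ≤ ζ) (hη : 0 ≤ η)
    (hX : IsSymmetricStableProcess P χ X) {v : ℝ} (hv : a ≤ v) :
    ∃ I, IsWienerIntegral P (ENNReal.ofReal χ) X ((Ioc a v).indicator (jacobiWeight ζ η)) I ∧
      IsStieltjesIntegral P a v (jacobiWeight ζ η) X I := by
  simpa using exists_isWienerIntegral_and_isStieltjesIntegral (h := 1) hχ hX hv measurable_one
    (by simp) (fun s t _ hst _ => IsWienerIntegral.increment hX.measurable_stepIntegral hst)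
    (continuous_jacobiWeight hζ hη).continuousOn

/-- `Y` is given only through limits of Riemann sums; almost sure uniqueness identifies it with the
extended integral, and the increment follows by linearity. -/
theorem IsJacobiProcess.isWienerIntegral_sub (hχ : 1 ≤ χ) (hζ : 0 ≤ ζ) (hη : 0 ≤ η)
    (hX : IsSymmetricStableProcess P χ X) (hY : IsJacobiProcess P ζ η a b X Y) {s t : ℝ}
    (has : a ≤ s) (hst : s ≤ t) (htb : t ≤ b) :
    IsWienerIntegral P (ENNReal.ofReal χ) X ((Ioc s t).indicator (jacobiWeight ζ η))
      (fun ω => Y t ω - Y s ω) := by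
  have hY' : ∀ v ∈ Icc a b, IsWienerIntegral P (ENNReal.ofReal χ) X
      ((Ioc a v).indicator (jacobiWeight ζ η)) (Y v) := by
    intro v hv
    obtain ⟨I, hI, hI'⟩ := exists_isWienerIntegral_jacobiWeight hχ hζ hη hX hv.1
    exact hI.congr_ae (hI'.ae_eq hv.1 (hY v hv))
  convert (hY' t ⟨has.trans hst, htb⟩).sub (by simpa using hχ) (hY' s ⟨has, hst.trans htb⟩) using 1
  ext u
  simp only [indicator, mem_Ioc]
  split_ifs <;> grind

theorem IsJacobiProcess.exists_isWienerIntegral (hχ : 1 ≤ χ) (hζ : 0 ≤ ζ) (hη : 0 ≤ η)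
    (ha : -1 ≤ a) (hab : a ≤ b) (hb : b ≤ 1) (hw : ∀ v ∈ Icc a b, jacobiWeight ζ η v ≤ 1)
    (hX : IsSymmetricStableProcess P χ X) (hY : IsJacobiProcess P ζ η a b X Y) {f : ℝ → ℝ}
    (hf : ContinuousOn f (Icc a b)) :
    ∃ I, IsWienerIntegral P (ENNReal.ofReal χ) X
        ((Ioc a b).indicator fun u => f u * jacobiWeight ζ η u) I ∧
      IsStieltjesIntegral P a b f Y I :=
  exists_isWienerIntegral_and_isStieltjesIntegral hχ hX hab
    (continuous_jacobiWeight hζ hη).measurable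
    (fun u hu => by rw [abs_of_nonneg (jacobiWeight_nonneg ha hb hu)]; exact hw u hu)
    (fun _ _ => hY.isWienerIntegral_sub hχ hζ hη hX) hf

theorem exists_isContinuousApprox (hζ : 0 ≤ ζ) (hη : 0 ≤ η) (ha : -1 ≤ a) (hb : b ≤ 1)
    {g : ℝ → ℝ} (hg : MemLp g (ENNReal.ofReal p) ((jacobiMeasure ζ η).restrict (Icc a b))) :
    ∃ gm : ℕ → ℝ → ℝ, IsContinuousApprox ζ η p a b g gm := by
  have := isFiniteMeasure_jacobiMeasure_restrict_Icc (a := a) (b := b) hζ hη ha hb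
  have hpos : ∀ n : ℕ, (2⁻¹ : ℝ≥0∞) ^ n ≠ 0 := fun n => (ENNReal.pow_pos (by simp) n).ne'
  choose gm hgm _ using fun n => hg.exists_boundedContinuous_eLpNorm_sub_le ENNReal.ofReal_ne_top
    (hpos n)
  refine ⟨fun n => gm n, fun n => (gm n).continuous.continuousOn,
    tendsto_of_tendsto_of_tendsto_of_le_of_le tendsto_const_nhds
      (ENNReal.tendsto_pow_atTop_nhds_zero_of_lt_one (r := 2⁻¹) (by simp)) (fun _ => zero_le)
      fun n => ?_⟩
  refine le_of_eq_of_le ?_ (hgm n)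
  exact eLpNorm_sub_comm _ _ _ _

/-- Hölder's inequality on a finite measure passes from `L^p(dμ)` to `L^χ(dμ)`, and the contraction
by the weight passes to Lebesgue measure. -/
theorem IsContinuousApprox.tendsto_eLpNorm_indicator_mul (hχ : 1 ≤ χ) (hp : χ ≤ p) (hζ : 0 ≤ ζ)
    (hη : 0 ≤ η) (ha : -1 ≤ a) (hb : b ≤ 1) (hw : ∀ v ∈ Icc a b, jacobiWeight ζ η v ≤ 1)
    {g : ℝ → ℝ} {gm : ℕ → ℝ → ℝ}
    (hg : AEStronglyMeasurable g ((jacobiMeasure ζ η).restrict (Icc a b)))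
    (hgm : IsContinuousApprox ζ η p a b g gm) :
    Tendsto (fun m => eLpNorm (fun u =>
      (Ioc a b).indicator (fun u => gm m u * jacobiWeight ζ η u) u -
        (Ioc a b).indicator (fun u => g u * jacobiWeight ζ η u) u) (ENNReal.ofReal χ) volume)
      atTop (𝓝 0) := by
  have := isFiniteMeasure_jacobiMeasure_restrict_Icc (a := a) (b := b) hζ hη ha hb
  set ν := (jacobiMeasure ζ η).restrict (Icc a b) with hν
  set M := ν univ ^ (1 / (ENNReal.ofReal χ).toReal - 1 / (ENNReal.ofReal p).toReal) with hM
  have hMtop : M ≠ ∞ := by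
    refine ENNReal.rpow_ne_top_of_nonneg ?_ (measure_ne_top _ _)
    rw [ENNReal.toReal_ofReal (by linarith), ENNReal.toReal_ofReal (by linarith), sub_nonneg]
    exact one_div_le_one_div_of_le (by linarith) hp
  have hlim : Tendsto (fun m => eLpNorm (fun v => gm m v - g v) (ENNReal.ofReal p) ν * M) atTop
      (𝓝 0) := by
    simpa using ENNReal.Tendsto.mul_const hgm.2 (Or.inr hMtop)
  refine tendsto_of_tendsto_of_tendsto_of_le_of_le tendsto_const_nhds hlim (fun _ => zero_le)
    fun m => ?_
  have hmeas : AEStronglyMeasurable (fun v => gm m v - g v) ν := by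
    refine AEStronglyMeasurable.sub ?_ hg
    exact (hgm.1 m).aestronglyMeasurable measurableSet_Icc
  refine le_trans (le_of_eq_of_le ?_ (eLpNorm_indicator_mul_jacobiWeight_le hζ hη ha hb hw hχ
    fun v => gm m v - g v))
    (eLpNorm_le_eLpNorm_mul_rpow_measure_univ (ENNReal.ofReal_le_ofReal hp) hmeas)
  congr 1
  ext u
  by_cases hu : u ∈ Ioc a b <;> simp [hu, sub_mul]

end JacobiProcess

theorem theorem3p1 {Ω : Type*} [MeasurableSpace Ω] (P : Measure Ω) [IsProbabilityMeasure P]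
    (χ p ζ η a b : ℝ) (hχ1 : 1 ≤ χ) (hχ2 : χ ≤ 2) (hp : χ ≤ p) (hζ : 0 ≤ ζ) (hη : 0 ≤ η)
    (ha : -1 ≤ a) (hab : a ≤ b) (hb : b ≤ 1) (hw : ∀ v ∈ Icc a b, jacobiWeight ζ η v ≤ 1)
    (X : ℝ → Ω → ℝ) (hX : IsSymmetricStableProcess P χ X) :
    (∃ Y : ℝ → Ω → ℝ, IsJacobiProcess P ζ η a b X Y) ∧
    ∀ Y : ℝ → Ω → ℝ, IsJacobiProcess P ζ η a b X Y →
      (∀ f : ℝ → ℝ, ContinuousOn f (Icc a b) →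
        ∃ I : Ω → ℝ, IsStieltjesIntegral P a b f Y I) ∧
      ∀ g : ℝ → ℝ, MemLp g (ENNReal.ofReal p) ((jacobiMeasure ζ η).restrict (Icc a b)) →
        (∃ gm : ℕ → ℝ → ℝ, IsContinuousApprox ζ η p a b g gm) ∧
        ∃ Z : Ω → ℝ, IsLimitIntegral P ζ η p a b g Y Z ∧
          ∀ Z' : Ω → ℝ, IsLimitIntegral P ζ η p a b g Y Z' → Z' =ᵐ[P] Z := by
  constructor
  · have h : ∀ v, ∃ I, v ∈ Icc a b → IsStieltjesIntegral P a v (jacobiWeight ζ η) X I := by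
      intro v
      by_cases hv : v ∈ Icc a b
      · obtain ⟨I, -, hI⟩ := exists_isWienerIntegral_jacobiWeight hχ1 hζ hη hX hv.1
        exact ⟨I, fun _ => hI⟩
      · exact ⟨0, fun hv' => absurd hv' hv⟩
    choose Y hY using h
    exact ⟨Y, hY⟩
  intro Y hY
  have hint := fun (f : ℝ → ℝ) (hf : ContinuousOn f (Icc a b)) =>
    hY.exists_isWienerIntegral hχ1 hζ hη ha hab hb hw hX hf
  refine ⟨fun f hf => (hint f hf).imp fun I hI => hI.2, fun g hg => ?_⟩
  obtain ⟨gm, hgm⟩ := exists_isContinuousApprox hζ hη ha hb hg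
  choose I hI hI' using fun m => hint (gm m) (hgm.1 m)
  obtain ⟨Z, hZ, -⟩ := IsWienerIntegral.exists_tendstoInMeasure hχ1 hX hI
    (aestronglyMeasurable_indicator_mul_jacobiWeight hζ hη ha hb hg.1)
    (hgm.tendsto_eLpNorm_indicator_mul hχ1 hp hζ hη ha hb hw hg.1)
  have hZlim : IsLimitIntegral P ζ η p a b g Y Z := by
    refine ⟨hZ.aemeasurable, fun hm J hhm hJ => ?_⟩
    refine IsWienerIntegral.tendstoInMeasure hχ1 hX (fun m => ?_) hZ
      (hhm.tendsto_eLpNorm_indicator_mul hχ1 hp hζ hη ha hb hw hg.1)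
    -- The given integral `J m` agrees almost surely with the constructed one, hence is itself an
    -- integral of `hm m * ϱ` against `X`.
    obtain ⟨K, hK, hK'⟩ := hint (hm m) (hhm.1 m)
    exact hK.congr_ae (hK'.ae_eq hab (hJ m))
  -- Uniqueness needs one approximating sequence whose integrals exist; `gm` serves.
  exact ⟨⟨gm, hgm⟩, Z, hZlim, fun Z' hZ' =>
    tendstoInMeasure_ae_unique (hZ'.2 gm I hgm hI') (hZlim.2 gm I hgm hI')⟩
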